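/- Let $D\subset\mathbb{C}^2$ be a convex domain (a non-empty convex open set) containing no complex lines, i.e. there are no $a,v\in\mathbb{C}^2$, $v\neq 0$, with $a+\mathbb{C}v\subset D$. Assume that $\partial D$ is $\mathcal{C}^{1,1}$-smooth, i.e. every $p\in\partial D$ has an open neighbourhood $U$ with a differentiable function $\varrho:U\to\mathbb{R}$ such that $d\varrho$ is Lipschitz and nowhere zero on $U$ and $D\cap U=\{z\in U:\varrho(z)<0\}$. Assume also that $\partial D$ contains an analytic disc, i.e. there is a non-constant holomorphic map $\varphi:\mathbb{D}\to\mathbb{C}^2$ of the open unit disc $\mathbb{D}$ with $\varphi(\mathbb{D})\subset\partial D$. For $z,w\in D$ let $$l_D(z,w)=\inf\{\tanh^{-1}|\alpha| : \alpha\in\mathbb{D},\ \exists\,\varphi:\mathbb{D}\to D\ \text{holomorphic with}\ \varphi(0)=z,\ \varphi(\alpha)=w\},$$ and let the Kobayashi distance $k_D$ be the largest pseudodistance on $D$ not exceeding $l_D$. Then $D$ is not Gromov hyperbolic with respect to $k_D$; that is, with $(x,y)_w=k_D(x,w)+k_D(w,y)-k_D(x,y)$, $$\sup_{p,q,x,w\in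 D}\Bigl(\min\{(p,x)_w,(x,q)_w\}-(p,q)_w\Bigr)=\infty .$$ -/

import Mathlib

open Metric Set

noncomputable section

namespace KobGromov

section Boundary

variable {E : Type*} [NormedAddCommGroup E] [NormedSpace ℝ E]

/-- The boundary of `D` is `C^{1,1}`-smooth: near every boundary point, `D` is the sublevel set
`{ρ < 0}` of a differentiable function with Lipschitz and nowhere vanishing derivative. -/
def HasC11Boundary (D : Set E) : Prop :=
  ∀ p ∈ frontier D, ∃ U : Set E, IsOpen U ∧ p ∈ U ∧ ∃ (ρ : E → ℝ) (K : NNReal),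
    DifferentiableOn ℝ ρ U ∧ LipschitzOnWith K (fderiv ℝ ρ) U ∧
    (∀ x ∈ U, fderiv ℝ ρ x ≠ 0) ∧ (∀ x ∈ U, x ∈ D ↔ ρ x < 0)

end Boundary

section Complex

variable {E : Type*} [NormedAddCommGroup E] [NormedSpace ℂ E]

/-- `S` contains a complex affine line. -/
def ContainsComplexLine (S : Set E) : Prop :=
  ∃ a v : E, v ≠ 0 ∧ ∀ ζ : ℂ, a + ζ • v ∈ S

/-- `φ` is a holomorphic map from the open unit disc into `S`. -/
def IsHolomorphicDisc (S : Set E) (φ : ℂ → E) : Prop :=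
  DifferentiableOn ℂ φ (ball 0 1) ∧ MapsTo φ (ball 0 1) S

/-- `S` contains an analytic disc: the image of a non-constant holomorphic map from the open
unit disc. -/
def ContainsAnalyticDisc (S : Set E) : Prop :=
  ∃ φ : ℂ → E, IsHolomorphicDisc S φ ∧ ∃ ζ ∈ ball (0 : ℂ) 1, φ ζ ≠ φ 0

/-- The Lempert function
`l_D(z,w) = inf {artanh |α| : φ holomorphic from the unit disc to D, φ(0) = z, φ(α) = w}`. -/
def lempertFunction (D : Set E) (z w : D) : ℝ :=
  sInf {r : ℝ | ∃ φ : ℂ → E, IsHolomorphicDisc D φ ∧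
    ∃ α ∈ ball (0 : ℂ) 1, φ 0 = z ∧ φ α = w ∧ r = Real.artanh ‖α‖}

/-- Pseudodistances on a type. -/
structure IsPseudodistance {X : Type*} (d : X → X → ℝ) : Prop where
  nonneg : ∀ x y, 0 ≤ d x y
  self : ∀ x, d x x = 0
  symm : ∀ x y, d x y = d y x
  triangle : ∀ x y z, d x z ≤ d x y + d y z

/-- The Kobayashi (pseudo)distance `k_D`: the largest pseudodistance on `D` not exceeding the
Lempert function. It is the pointwise supremum of all such pseudodistances, which is again
one of them. -/
def kobayashiDist (D : Set E) (z w : D) : ℝ :=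
  sSup {r : ℝ | ∃ d : D → D → ℝ, IsPseudodistance d ∧
    (∀ x y, d x y ≤ lempertFunction D x y) ∧ r = d z w}

end Complex

section Gromov

variable {X : Type*}

/-- The Gromov product `(x,y)_z` (without the factor `1/2`). -/
def gromovProduct (d : X → X → ℝ) (x y z : X) : ℝ :=
  d x z + d z y - d x y

/-- `S_d(p,q,x,w) = min {(p,x)_w, (x,q)_w} - (p,q)_w`. -/
def gromovS (d : X → X → ℝ) (p q x w : X) : ℝ :=
  min (gromovProduct d p x w) (gromovProduct d x q w) - gromovProduct d p q w

/-- Gromov hyperbolicity: `S_d` is bounded above. -/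
def IsGromovHyperbolic (d : X → X → ℝ) : Prop :=
  ∃ C : ℝ, ∀ p q x w : X, gromovS d p q x w ≤ C

end Gromov

end KobGromov

end

/-!
By the Borel–Carathéodory inequality in each supporting half-space, an analytic disc `φ` in the
boundary with `φ α ≠ φ 0` forces an affine disc around `φ 0`, in the complex line through `φ 0` and
`φ α`, to lie in the boundary too. As `D` contains no complex line, a largest affine disc around
`φ 0` in this line touches the end of the face at a point `c`. The `C^{1,1}` condition provides
discs in `D` of a fixed radius, tangent to the boundary at the points of the face near `c` and
transversal to the face, so `D` contains an affine bidisc with corner `c`.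

In logarithmic coordinates at its corner, a bidisc looks like a quadrant of the `ℓ^∞`-plane, and
for points near the face the Kobayashi distance of `D` is still bounded below, up to additive
constants, by half of either logarithmic coordinate difference, through supporting half-spaces of
`D`. The square with vertices `(a, 0)`, `(a, 2T)`, `(a + T, T)`, `(a - T, T)` has sides of length at
most `(T + log 2) / 2` and diagonals of length at least `T - (log 2) / 2` and `T`. Hence the
four-point defect is at least `T - (3/2) log 2`, for every `T`.
-/

namespace KobGromov

open Filter Topology

section HalfPlane

theorem norm_sub_lt_norm_add_conj {z w : ℂ} (hz : 0 < z.re) (hw : 0 < w.re) :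
    ‖z - w‖ < ‖z + starRingEnd ℂ w‖ := by
  refine lt_of_pow_lt_pow_left₀ 2 (norm_nonneg _) ?_
  rw [Complex.sq_norm, Complex.sq_norm, Complex.normSq_apply, Complex.normSq_apply]
  simp only [Complex.add_re, Complex.add_im, Complex.sub_re, Complex.sub_im,
    Complex.conj_re, Complex.conj_im]
  nlinarith [mul_pos hz hw]

theorem IsHolomorphicDisc.norm_sub_le_norm_mul_norm_add_conj {g : ℂ → ℂ}
    (hg : IsHolomorphicDisc {z : ℂ | 0 < z.re} g) {α : ℂ} (hα : α ∈ ball (0 : ℂ) 1) :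
    ‖g α - g 0‖ ≤ ‖α‖ * ‖g α + starRingEnd ℂ (g 0)‖ := by
  have hlt : ∀ ζ ∈ ball (0 : ℂ) 1, ‖g ζ - g 0‖ < ‖g ζ + starRingEnd ℂ (g 0)‖ := fun ζ hζ =>
    norm_sub_lt_norm_add_conj (hg.2 hζ) (hg.2 (mem_ball_self one_pos))
  have hpos : ∀ ζ ∈ ball (0 : ℂ) 1, 0 < ‖g ζ + starRingEnd ℂ (g 0)‖ := fun ζ hζ =>
    (norm_nonneg _).trans_lt (hlt ζ hζ)
  have schwarz : ‖(g α - g 0) / (g α + starRingEnd ℂ (g 0))‖ ≤ ‖α‖ := by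
    refine Complex.norm_le_norm_of_mapsTo_ball (R := 1)
      (f := fun ζ => (g ζ - g 0) / (g ζ + starRingEnd ℂ (g 0))) ?_ ?_ (by simp)
      (mem_ball_zero_iff.1 hα)
    · exact (hg.1.sub_const _).div (hg.1.add_const _) fun ζ hζ => norm_pos_iff.1 (hpos ζ hζ)
    · intro ζ hζ
      rw [mem_closedBall_zero_iff, norm_div]
      exact div_le_one_of_le₀ (hlt ζ hζ).le (norm_nonneg _)
  rwa [norm_div, div_le_iff₀ (hpos α hα)] at schwarz

theorem IsHolomorphicDisc.abs_re_sub_re_le {g : ℂ → ℂ}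
    (hg : IsHolomorphicDisc {z : ℂ | 0 < z.re} g) {α : ℂ} (hα : α ∈ ball (0 : ℂ) 1) :
    |(g α).re - (g 0).re| ≤ ‖α‖ * ((g α).re + (g 0).re) := by
  have hre : 0 < (g α).re + (g 0).re := add_pos (hg.2 hα) (hg.2 (mem_ball_self one_pos))
  have hα1 : ‖α‖ ^ 2 ≤ 1 := pow_le_one₀ (norm_nonneg α) (mem_ball_zero_iff.1 hα).le
  have hsq := pow_le_pow_left₀ (norm_nonneg _) (hg.norm_sub_le_norm_mul_norm_add_conj hα) 2
  rw [mul_pow, Complex.sq_norm (g α - g 0), Complex.sq_norm (g α + _), Complex.normSq_apply,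
    Complex.normSq_apply] at hsq
  simp only [Complex.add_re, Complex.add_im, Complex.sub_re, Complex.sub_im,
    Complex.conj_re, Complex.conj_im] at hsq
  refine abs_le_of_sq_le_sq ?_ (by positivity)
  nlinarith [mul_nonneg (sub_nonneg.2 hα1) (sq_nonneg ((g α).im - (g 0).im))]

theorem artanh_sub_div_add {x y : ℝ} (hx : 0 < x) (hy : 0 < y) :
    Real.artanh ((x - y) / (x + y)) = 1 / 2 * (Real.log x - Real.log y) := by
  have hxy : 0 < x + y := add_pos hx hy
  have hmem : (x - y) / (x + y) ∈ Icc (-1) 1 :=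
    ⟨by rw [le_div_iff₀ hxy]; linarith, by rw [div_le_iff₀ hxy]; linarith⟩
  rw [Real.artanh_eq_half_log hmem, ← Real.log_div hx.ne' hy.ne', one_add_div hxy.ne',
    one_sub_div hxy.ne', div_div_div_cancel_right₀ hxy.ne', add_add_sub_cancel, add_sub_sub_cancel,
    ← two_mul, ← two_mul, mul_div_mul_left _ _ two_ne_zero]

theorem log_sub_log_le_artanh {x y t : ℝ} (hx : 0 < x) (hy : 0 < y) (ht : t < 1)
    (h : x - y ≤ t * (x + y)) : 1 / 2 * (Real.log x - Real.log y) ≤ Real.artanh t := by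
  have hxy : 0 < x + y := add_pos hx hy
  rw [← artanh_sub_div_add hx hy]
  exact Real.artanh_le_artanh (by rw [lt_div_iff₀ hxy]; linarith) ht ((div_le_iff₀ hxy).2 h)

theorem IsHolomorphicDisc.abs_log_re_sub_log_re_le {g : ℂ → ℂ}
    (hg : IsHolomorphicDisc {z : ℂ | 0 < z.re} g) {α : ℂ} (hα : α ∈ ball (0 : ℂ) 1) :
    1 / 2 * |Real.log (g 0).re - Real.log (g α).re| ≤ Real.artanh ‖α‖ := by
  have h0 : 0 < (g 0).re := hg.2 (mem_ball_self one_pos)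
  have h1 : 0 < (g α).re := hg.2 hα
  have hα1 := mem_ball_zero_iff.1 hα
  obtain ⟨hl, hu⟩ := abs_le.1 (hg.abs_re_sub_re_le hα)
  rcases abs_cases (Real.log (g 0).re - Real.log (g α).re) with ⟨h, -⟩ | ⟨h, -⟩ <;> rw [h]
  · exact log_sub_log_le_artanh h0 h1 hα1 (by linarith)
  · rw [neg_sub]
    exact log_sub_log_le_artanh h1 h0 hα1 hu

theorem one_sub_ne_zero_of_mem_ball {ζ : ℂ} (hζ : ζ ∈ ball (0 : ℂ) 1) : 1 - ζ ≠ 0 := by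
  rw [sub_ne_zero]
  rintro rfl
  simp at hζ

theorem isHolomorphicDisc_cayley :
    IsHolomorphicDisc {z : ℂ | 0 < z.re} fun ζ => (1 + ζ) / (1 - ζ) := by
  refine ⟨DifferentiableOn.div (by fun_prop) (by fun_prop)
    fun ζ => one_sub_ne_zero_of_mem_ball, fun ζ hζ => ?_⟩
  have hden : 0 < Complex.normSq (1 - ζ) :=
    Complex.normSq_pos.2 (one_sub_ne_zero_of_mem_ball hζ)
  have hnum : 0 < 1 - Complex.normSq ζ := by
    rw [← Complex.sq_norm, sub_pos]
    exact pow_lt_one₀ (norm_nonneg ζ) (mem_ball_zero_iff.1 hζ) two_ne_zero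
  have hre : ((1 + ζ) / (1 - ζ)).re = (1 - Complex.normSq ζ) / Complex.normSq (1 - ζ) := by
    rw [Complex.div_re, ← add_div, Complex.normSq_apply ζ]
    simp only [Complex.add_re, Complex.add_im, Complex.sub_re, Complex.sub_im, Complex.one_re,
      Complex.one_im]
    ring
  rw [mem_ofPred_eq, hre]
  exact div_pos hnum hden

theorem IsHolomorphicDisc.comp_neg {E : Type*} [NormedAddCommGroup E] [NormedSpace ℂ E]
    {S : Set E} {φ : ℂ → E} (hφ : IsHolomorphicDisc S φ) : IsHolomorphicDisc S fun ζ => φ (-ζ) := by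
  have hneg : MapsTo (fun ζ : ℂ => -ζ) (ball 0 1) (ball 0 1) := fun ζ hζ => by simpa using hζ
  exact ⟨hφ.1.comp (differentiableOn_neg _) hneg, hφ.2.comp hneg⟩

theorem one_add_tanh_div_one_sub_tanh (R : ℝ) :
    (1 + Real.tanh R) / (1 - Real.tanh R) = Real.exp (2 * R) := by
  have hcosh := Real.cosh_pos R
  rw [Real.tanh_eq_sinh_div_cosh, one_add_div hcosh.ne', one_sub_div hcosh.ne',
    div_div_div_cancel_right₀ hcosh.ne', Real.cosh_add_sinh, Real.cosh_sub_sinh, ← Real.exp_sub]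
  congr 1
  ring

theorem tanh_mem_ball (R : ℝ) : (Real.tanh R : ℂ) ∈ ball (0 : ℂ) 1 := by
  rw [mem_ball_zero_iff, Complex.norm_real, Real.norm_eq_abs]
  exact Real.abs_tanh_lt_one R

-- With `c` the Cayley transform, `u / c` and `u * c` are the extremal discs through `u`; their
-- convex combinations reach everything in between.
theorem exists_holomorphicDisc_halfPlane {u v R : ℝ} (hu : 0 < u) (huv : u ≤ Real.exp (2 * R) * v)
    (hvu : v ≤ Real.exp (2 * R) * u) :
    ∃ g : ℂ → ℂ, IsHolomorphicDisc {z : ℂ | 0 < z.re} g ∧ g 0 = u ∧ g (Real.tanh R) = v := by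
  set C := Real.exp (2 * R) with hC
  have hC0 : 0 < C := Real.exp_pos _
  have hv : v ∈ segment ℝ (u / C) (C * u) := by
    have h : u / C ≤ v := (div_le_iff₀ hC0).2 (by linarith)
    rw [segment_eq_Icc (h.trans hvu)]
    exact ⟨h, hvu⟩
  obtain ⟨s, t, hs, ht, hst, rfl⟩ := hv
  have hcayley := isHolomorphicDisc_cayley
  have hcayley' := isHolomorphicDisc_cayley.comp_neg
  have hval : (1 + (Real.tanh R : ℂ)) / (1 - Real.tanh R) = C := by
    rw [hC, ← one_add_tanh_div_one_sub_tanh]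
    push_cast
    rfl
  refine ⟨fun ζ => s * (u * ((1 + -ζ) / (1 - -ζ))) + t * (u * ((1 + ζ) / (1 - ζ))),
    ⟨?_, fun ζ hζ => ?_⟩, ?_, ?_⟩
  · exact ((hcayley'.1.const_mul _).const_mul _).add ((hcayley.1.const_mul _).const_mul _)
  · have h1 := mul_pos hu (hcayley.2 hζ)
    have h2 := mul_pos hu (hcayley'.2 hζ)
    simp only [mem_ofPred_eq, Complex.add_re, Complex.re_ofReal_mul]
    exact convex_Ioi (0 : ℝ) h2 h1 hs ht hst
  · have : (s : ℂ) + t = 1 := by exact_mod_cast hst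
    simp [← add_mul, this]
  · simp only [← sub_eq_add_neg, sub_neg_eq_add, ← inv_div (1 + (Real.tanh R : ℂ)), hval]
    simp only [smul_eq_mul]
    push_cast
    ring

theorem IsHolomorphicDisc.two_div_add_one {g : ℂ → ℂ}
    (hg : IsHolomorphicDisc {z : ℂ | 0 < z.re} g) :
    IsHolomorphicDisc (ball 1 1) fun ζ => 2 / (g ζ + 1) := by
  have hlt : ∀ ζ ∈ ball (0 : ℂ) 1, ‖g ζ - 1‖ < ‖g ζ + 1‖ := fun ζ hζ => by
    simpa using norm_sub_lt_norm_add_conj (hg.2 hζ) (w := 1) (by simp)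
  have hne : ∀ ζ ∈ ball (0 : ℂ) 1, g ζ + 1 ≠ 0 := fun ζ hζ =>
    norm_pos_iff.1 ((norm_nonneg _).trans_lt (hlt ζ hζ))
  refine ⟨(differentiableOn_const _).div (hg.1.add_const 1) hne, fun ζ hζ => ?_⟩
  have hsub : 2 / (g ζ + 1) - 1 = -((g ζ - 1) / (g ζ + 1)) := by
    field_simp [hne ζ hζ]
    ring
  rw [mem_ball_iff_norm, hsub, norm_neg, norm_div, div_lt_one (norm_pos_iff.2 (hne ζ hζ))]
  exact hlt ζ hζ

theorem exists_holomorphicDisc_ball_exp_neg {a a' T : ℝ} (ha : 0 ≤ a) (ha' : 0 ≤ a')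
    (hT : |a - a'| ≤ T) :
    ∃ m : ℂ → ℂ, IsHolomorphicDisc (ball 1 1) m ∧ m 0 = Real.exp (-a) ∧
      m (Real.tanh (1 / 2 * (T + Real.log 2))) = Real.exp (-a') := by
  have hle : ∀ {x y : ℝ}, 0 ≤ x → y - x ≤ T → 2 * Real.exp y - 1 ≤
      Real.exp (2 * (1 / 2 * (T + Real.log 2))) * (2 * Real.exp x - 1) := by
    intro x y hx hxy
    have h1 : Real.exp y ≤ Real.exp T * Real.exp x := by
      rw [← Real.exp_add, Real.exp_le_exp]
      linarith
    rw [← mul_assoc, mul_one_div_cancel two_ne_zero, one_mul, Real.exp_add, Real.exp_log two_pos]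
    nlinarith [Real.exp_pos T, Real.one_le_exp hx]
  obtain ⟨hl, hu⟩ := abs_le.1 hT
  obtain ⟨g, hg, hg0, hg1⟩ := exists_holomorphicDisc_halfPlane
    (show 0 < 2 * Real.exp a - 1 by linarith [Real.one_le_exp ha])
    (hle ha' hu) (hle ha (by linarith))
  have hval : ∀ x : ℝ, 2 / (((2 * Real.exp x - 1 : ℝ) : ℂ) + 1) = Real.exp (-x) := by
    intro x
    rw [← Complex.ofReal_one, ← Complex.ofReal_add, sub_add_cancel, Real.exp_neg]
    push_cast
    rw [div_mul_cancel_left₀ two_ne_zero]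
  exact ⟨fun ζ => 2 / (g ζ + 1), hg.two_div_add_one, by simp only [hg0, hval],
    by simp only [hg1, hval]⟩

end HalfPlane

section JoiningDiscs

theorem exists_norm_cos_sub_cos_re_lt {ε : ℝ} (hε : 0 < ε) :
    ∃ δ > 0, ∀ w : ℂ, |w.im| < δ → ‖Complex.cos w - Real.cos w.re‖ < ε := by
  have hcont : Continuous fun y : ℝ => |Real.cosh y - 1| + |Real.sinh y| := by fun_prop
  obtain ⟨δ, hδ, h⟩ := Metric.continuous_iff.1 hcont 0 ε hε
  refine ⟨δ, hδ, fun w hw => ?_⟩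
  have hlt := h w.im (by simpa using hw)
  rw [Real.dist_eq, Real.cosh_zero, Real.sinh_zero, sub_self, abs_zero, add_zero, sub_zero,
    abs_of_nonneg (by positivity)] at hlt
  have hexpand : Complex.cos w - Real.cos w.re =
      Real.cos w.re * (Real.cosh w.im - 1 : ℝ) - Real.sin w.re * Real.sinh w.im * Complex.I := by
    rw [Complex.cos_eq]
    push_cast
    ring
  rw [hexpand]
  refine (norm_sub_le _ _).trans_lt (lt_of_le_of_lt ?_ hlt)
  simp only [norm_mul, Complex.norm_real, Complex.norm_I, mul_one, Real.norm_eq_abs]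
  gcongr
  · exact mul_le_of_le_one_left (abs_nonneg _) (Real.abs_cos_le_one _)
  · exact mul_le_of_le_one_left (abs_nonneg _) (Real.abs_sin_le_one _)

theorem isHolomorphicDisc_log_sub_log :
    IsHolomorphicDisc {w : ℂ | |w.im| ≤ 2 * Real.pi}
      fun ζ => Complex.log (1 + ζ) - Complex.log (1 + -ζ) := by
  have hlog : IsHolomorphicDisc {w : ℂ | |w.im| ≤ Real.pi} fun ζ => Complex.log (1 + ζ) := by
    refine ⟨DifferentiableOn.clog (by fun_prop) fun ζ hζ =>
      Complex.mem_slitPlane_of_norm_lt_one (mem_ball_zero_iff.1 hζ), fun ζ _ => ?_⟩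
    rw [mem_ofPred_eq, Complex.log_im]
    exact Complex.abs_arg_le_pi _
  refine ⟨hlog.1.sub hlog.comp_neg.1, fun ζ hζ => ?_⟩
  have h1 : |(Complex.log (1 + ζ)).im| ≤ Real.pi := hlog.2 hζ
  have h2 : |(Complex.log (1 + -ζ)).im| ≤ Real.pi := hlog.comp_neg.2 hζ
  rw [mem_ofPred_eq, Complex.sub_im]
  linarith [abs_sub (Complex.log (1 + ζ)).im (Complex.log (1 + -ζ)).im]

theorem log_sub_log_tanh (R : ℝ) :
    Complex.log (1 + Real.tanh R) - Complex.log (1 + -Real.tanh R) = (2 * R : ℝ) := by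
  have h1 : 0 < 1 + Real.tanh R := by linarith [Real.neg_one_lt_tanh R]
  have h2 : 0 < 1 - Real.tanh R := by linarith [Real.tanh_lt_one R]
  rw [← Real.log_exp (2 * R), ← one_add_tanh_div_one_sub_tanh, Real.log_div h1.ne' h2.ne',
    Complex.ofReal_sub, Complex.ofReal_log h1.le, Complex.ofReal_log h2.le]
  push_cast
  rw [← sub_eq_add_neg]

theorem one_sub_cos_div_two_mem_thickening {ε : ℝ} {w : ℂ}
    (h : ‖Complex.cos w - Real.cos w.re‖ < ε) :
    (1 - Complex.cos w) / 2 ∈ thickening ε ((fun t : ℝ => (t : ℂ)) '' Icc 0 1) := by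
  have hIcc : (1 - Real.cos w.re) / 2 ∈ Icc (0 : ℝ) 1 := by
    constructor <;> linarith [Real.cos_le_one w.re, Real.neg_one_le_cos w.re]
  have hdiff : (1 - Complex.cos w) / 2 - ((1 - Real.cos w.re) / 2 : ℝ) =
      -(Complex.cos w - Real.cos w.re) / 2 := by
    push_cast
    ring
  refine mem_thickening_iff.2 ⟨_, mem_image_of_mem _ hIcc, ?_⟩
  rw [dist_eq_norm, hdiff, norm_div, norm_neg, Complex.norm_ofNat]
  linarith [norm_nonneg (Complex.cos w - Real.cos w.re)]

-- The cosine maps a thin horizontal strip into a thin neighbourhood of `[-1, 1]`.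
theorem exists_holomorphicDisc_thickening_Icc {ε : ℝ} (hε : 0 < ε) :
    ∃ φ : ℂ → ℂ, IsHolomorphicDisc (thickening ε ((fun t : ℝ => (t : ℂ)) '' Icc 0 1)) φ ∧
      ∃ α ∈ ball (0 : ℂ) 1, φ 0 = 0 ∧ φ α = 1 := by
  obtain ⟨δ, hδ, hcos⟩ := exists_norm_cos_sub_cos_re_lt hε
  obtain ⟨η, hη, hηδ⟩ : ∃ η > 0, η * (2 * Real.pi) < δ :=
    ⟨δ / (2 * (2 * Real.pi)), by positivity, by field_simp; norm_num⟩
  have hlog := isHolomorphicDisc_log_sub_log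
  refine ⟨fun ζ => (1 - Complex.cos (η * (Complex.log (1 + ζ) - Complex.log (1 + -ζ)))) / 2,
    ⟨?_, fun ζ hζ => one_sub_cos_div_two_mem_thickening (hcos _ ?_)⟩,
    Real.tanh (Real.pi / (2 * η)), tanh_mem_ball _, by simp, ?_⟩
  · exact (((hlog.1.const_mul _).ccos).const_sub 1).div_const 2
  · rw [Complex.im_ofReal_mul, abs_mul, abs_of_pos hη]
    exact (mul_le_mul_of_nonneg_left (hlog.2 hζ) hη.le).trans_lt hηδ
  · have hpi : (η : ℂ) * (2 * (Real.pi / (2 * η)) : ℝ) = Real.pi := by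
      rw [← Complex.ofReal_mul]
      congr 1
      field_simp
    simp only [log_sub_log_tanh, hpi, Complex.cos_pi]
    norm_num

theorem exists_holomorphicDisc {E : Type*} [NormedAddCommGroup E] [NormedSpace ℂ E] {D : Set E}
    (hD : IsOpen D) (hc : Convex ℝ D) {z w : E} (hz : z ∈ D) (hw : w ∈ D) :
    ∃ φ : ℂ → E, IsHolomorphicDisc D φ ∧ ∃ α ∈ ball (0 : ℂ) 1, φ 0 = z ∧ φ α = w := by
  have hcont : Continuous fun ζ : ℂ => z + ζ • (w - z) := by fun_prop
  have hsegment : (fun t : ℝ => (t : ℂ)) '' Icc 0 1 ⊆ (fun ζ : ℂ => z + ζ • (w - z)) ⁻¹' D := by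
    rintro _ ⟨t, ht, rfl⟩
    simpa using hc.add_smul_sub_mem hz hw ht
  obtain ⟨ε, hε, hsub⟩ := (isCompact_Icc.image
    Complex.continuous_ofReal).exists_thickening_subset_open (hD.preimage hcont) hsegment
  obtain ⟨φ, hφ, α, hα, h0, h1⟩ := exists_holomorphicDisc_thickening_Icc hε
  exact ⟨fun ζ => z + φ ζ • (w - z), ⟨(hφ.1.smul_const _).const_add _, fun ζ hζ => hsub (hφ.2 hζ)⟩,
    α, hα, by simp [h0], by simp [h1]⟩

end JoiningDiscs

section KobayashiDistance

variable {E : Type*} [NormedAddCommGroup E] [NormedSpace ℂ E] {D : Set E}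

theorem lempertFunction_nonneg (z w : D) : 0 ≤ lempertFunction D z w := by
  refine Real.sInf_nonneg ?_
  rintro r ⟨-, -, α, -, -, -, rfl⟩
  exact Real.artanh_nonneg (norm_nonneg α)

theorem IsHolomorphicDisc.lempertFunction_le {φ : ℂ → E} (hφ : IsHolomorphicDisc D φ) {α : ℂ}
    (hα : α ∈ ball (0 : ℂ) 1) {z w : D} (h0 : φ 0 = z) (h1 : φ α = w) :
    lempertFunction D z w ≤ Real.artanh ‖α‖ := by
  refine csInf_le ⟨0, ?_⟩ ⟨φ, hφ, α, hα, h0, h1, rfl⟩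
  rintro r ⟨-, -, α, -, -, -, rfl⟩
  exact Real.artanh_nonneg (norm_nonneg α)

theorem kobayashiDist_le_lempertFunction (z w : D) :
    kobayashiDist D z w ≤ lempertFunction D z w := by
  refine Real.sSup_le ?_ (lempertFunction_nonneg z w)
  rintro r ⟨d, -, hd, rfl⟩
  exact hd z w

theorem IsPseudodistance.le_kobayashiDist {d : D → D → ℝ} (hd : IsPseudodistance d)
    (hle : ∀ x y, d x y ≤ lempertFunction D x y) (z w : D) : d z w ≤ kobayashiDist D z w := by
  refine le_csSup ⟨lempertFunction D z w, ?_⟩ ⟨d, hd, hle, rfl⟩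
  rintro r ⟨d', -, hd', rfl⟩
  exact hd' z w

theorem isPseudodistance_half_abs_sub {X : Type*} (u : X → ℝ) :
    IsPseudodistance fun x y => 1 / 2 * |u x - u y| where
  nonneg _ _ := by positivity
  self _ := by simp
  symm x y := by rw [abs_sub_comm]
  triangle x y z := by linarith [abs_sub_le (u x) (u y) (u z)]

theorem half_abs_log_re_sub_log_re_le_kobayashiDist (hD : IsOpen D) (hc : Convex ℝ D) {g : E → ℂ}
    (hg : DifferentiableOn ℂ g D) (hpos : MapsTo g D {z : ℂ | 0 < z.re}) (z w : D) :
    1 / 2 * |Real.log (g z).re - Real.log (g w).re| ≤ kobayashiDist D z w := by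
  refine (isPseudodistance_half_abs_sub fun z : D => Real.log (g z).re).le_kobayashiDist
    (fun x y => ?_) z w
  obtain ⟨φ₀, hφ₀, α₀, hα₀, h⟩ := exists_holomorphicDisc hD hc x.2 y.2
  refine le_csInf ⟨_, φ₀, hφ₀, α₀, hα₀, h.1, h.2, rfl⟩ ?_
  rintro r ⟨φ, hφ, α, hα, h0, h1, rfl⟩
  have hgφ : IsHolomorphicDisc {z : ℂ | 0 < z.re} (g ∘ φ) :=
    ⟨hg.comp hφ.1 hφ.2, hpos.comp hφ.2⟩
  simpa only [Function.comp_apply, h0, h1] using hgφ.abs_log_re_sub_log_re_le hα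

theorem half_abs_log_sub_log_le_kobayashiDist_of_notMem (hD : IsOpen D) (hc : Convex ℝ D)
    {y e : E} (hy : y ∉ D) {s t : ℝ} (hs : 0 < s) (ht : 0 < t) {z w : D}
    (hz : (z : E) = y + s • e) (hw : (w : E) = y + t • e) :
    1 / 2 * |Real.log s - Real.log t| ≤ kobayashiDist D z w := by
  obtain ⟨f, hf⟩ := RCLike.geometric_hahn_banach_point_open (𝕜 := ℂ) hc hD hy
  have hpos : MapsTo (fun x => f x - f y) D {z : ℂ | 0 < z.re} := fun x hx => by
    rw [mem_ofPred_eq, Complex.sub_re]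
    exact sub_pos.2 (hf x hx)
  have hre : ∀ r : ℝ, (f (y + r • e) - f y).re = r * (f e).re := fun r => by
    rw [map_add, add_sub_cancel_left, ← Complex.coe_smul, map_smul, smul_eq_mul,
      Complex.re_ofReal_mul]
  have hfe : 0 < (f e).re := by
    have : 0 < (f z - f y).re := hpos z.2
    rw [hz, hre] at this
    exact pos_of_mul_pos_right this hs.le
  have hlog := half_abs_log_re_sub_log_re_le_kobayashiDist hD hc
    (g := fun x => f x - f y) (by fun_prop) hpos z w
  rwa [hz, hw, hre, hre, Real.log_mul hs.ne' hfe.ne', Real.log_mul ht.ne' hfe.ne',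
    add_sub_add_right_eq_sub] at hlog

end KobayashiDistance

section Bidisc

variable {E : Type*} [NormedAddCommGroup E] [NormedSpace ℂ E] {D : Set E} {c n e : E}

/-- The affine bidisc with corner `c` in the complex directions `n` and `e`. Both unit discs of
parameters are centred at `1`, so that the corner corresponds to the parameters `(0, 0)`. -/
def bidisc (c n e : E) : Set E :=
  image2 (fun z₁ z₂ : ℂ => c + z₁ • n + z₂ • e) (ball 1 1) (ball 1 1)

/-- The point with logarithmic coordinates `(a, b)` relative to the corner `c`. In these
coordinates `bidisc c n e` with its Kobayashi distance is roughly a quadrant with the distance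
`max (|a - a'|) (|b - b'|) / 2`. -/
noncomputable def bidiscPoint (c n e : E) (a b : ℝ) : E :=
  c + Real.exp (-a) • n + Real.exp (-b) • e

theorem ofReal_exp_neg_mem_ball {a : ℝ} (ha : 0 ≤ a) : (Real.exp (-a) : ℂ) ∈ ball (1 : ℂ) 1 := by
  rw [mem_ball_iff_norm', ← Complex.ofReal_one, ← Complex.ofReal_sub, Complex.norm_real,
    Real.norm_eq_abs, abs_of_nonneg (sub_nonneg.2 (Real.exp_le_one_iff.2 (neg_nonpos.2 ha)))]
  linarith [Real.exp_pos (-a)]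

theorem bidiscPoint_mem_bidisc {a b : ℝ} (ha : 0 ≤ a) (hb : 0 ≤ b) :
    bidiscPoint c n e a b ∈ bidisc c n e :=
  ⟨Real.exp (-a), ofReal_exp_neg_mem_ball ha, Real.exp (-b), ofReal_exp_neg_mem_ball hb, by
    simp only [Complex.coe_smul, bidiscPoint]⟩

theorem kobayashiDist_le_of_bidisc_subset (hsub : bidisc c n e ⊆ D) {a b a' b' T : ℝ}
    (ha : 0 ≤ a) (hb : 0 ≤ b) (ha' : 0 ≤ a') (hb' : 0 ≤ b') (haT : |a - a'| ≤ T)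
    (hbT : |b - b'| ≤ T) {z w : D} (hz : (z : E) = bidiscPoint c n e a b)
    (hw : (w : E) = bidiscPoint c n e a' b') :
    kobayashiDist D z w ≤ 1 / 2 * (T + Real.log 2) := by
  obtain ⟨m₁, hm₁, h10, h11⟩ := exists_holomorphicDisc_ball_exp_neg ha ha' haT
  obtain ⟨m₂, hm₂, h20, h21⟩ := exists_holomorphicDisc_ball_exp_neg hb hb' hbT
  set R := 1 / 2 * (T + Real.log 2)
  have hR0 : 0 ≤ R := by
    have := Real.log_nonneg one_le_two
    have := (abs_nonneg _).trans haT
    positivity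
  have htanh : 0 ≤ Real.tanh R := by
    rw [Real.tanh_eq_sinh_div_cosh]
    exact div_nonneg (Real.sinh_nonneg_iff.2 hR0) (Real.cosh_pos R).le
  have hφ : IsHolomorphicDisc D fun ζ => c + m₁ ζ • n + m₂ ζ • e :=
    ⟨((hm₁.1.smul_const n).const_add c).add (hm₂.1.smul_const e),
      fun ζ hζ => hsub (mem_image2_of_mem (hm₁.2 hζ) (hm₂.2 hζ))⟩
  calc kobayashiDist D z w ≤ lempertFunction D z w := kobayashiDist_le_lempertFunction z w
    _ ≤ Real.artanh ‖(Real.tanh R : ℂ)‖ := hφ.lempertFunction_le (tanh_mem_ball R)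
        (by rw [h10, h20, Complex.coe_smul, Complex.coe_smul, hz, bidiscPoint])
        (by rw [h11, h21, Complex.coe_smul, Complex.coe_smul, hw, bidiscPoint])
    _ = R := by
        rw [Complex.norm_real, Real.norm_eq_abs, abs_of_nonneg htanh, Real.artanh_tanh]

theorem half_abs_sub_le_kobayashiDist_of_notMem (hD : IsOpen D) (hc : Convex ℝ D) {a a' b : ℝ}
    (hb : c + Real.exp (-b) • e ∉ D) {z w : D} (hz : (z : E) = bidiscPoint c n e a b)
    (hw : (w : E) = bidiscPoint c n e a' b) : 1 / 2 * |a - a'| ≤ kobayashiDist D z w := by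
  rw [bidiscPoint, add_right_comm] at hz hw
  have hlog := half_abs_log_sub_log_le_kobayashiDist_of_notMem hD hc hb (Real.exp_pos _)
    (Real.exp_pos _) hz hw
  rwa [Real.log_exp, Real.log_exp, neg_sub_neg, abs_sub_comm] at hlog

theorem half_sub_log_two_le_kobayashiDist_of_notMem (hD : IsOpen D) (hc : Convex ℝ D) {a b : ℝ}
    (hab : c + Real.exp (-a) • n - Real.exp (-b) • e ∉ D) {z w : D}
    (hz : (z : E) = bidiscPoint c n e a 0) (hw : (w : E) = bidiscPoint c n e a b) :
    1 / 2 * (b - Real.log 2) ≤ kobayashiDist D z w := by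
  have hpoint : ∀ t : ℝ, bidiscPoint c n e a t =
      c + Real.exp (-a) • n - Real.exp (-b) • e + (Real.exp (-t) + Real.exp (-b)) • e := fun t => by
    rw [bidiscPoint, add_smul]
    abel
  have hlog := half_abs_log_sub_log_le_kobayashiDist_of_notMem hD hc hab
    (add_pos (Real.exp_pos _) (Real.exp_pos _)) (add_pos (Real.exp_pos _) (Real.exp_pos _))
    (hz.trans (hpoint 0)) (hw.trans (hpoint b))
  have hz0 : 0 ≤ Real.log (1 + Real.exp (-b)) := Real.log_nonneg (by linarith [Real.exp_pos (-b)])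
  rw [neg_zero, Real.exp_zero, ← two_mul, Real.log_mul two_ne_zero (Real.exp_pos _).ne',
    Real.log_exp, ← sub_eq_add_neg] at hlog
  linarith [le_abs_self (Real.log (1 + Real.exp (-b)) - (Real.log 2 - b))]

theorem le_gromovS {X : Type*} {d : X → X → ℝ} {p q x w : X} {A B S : ℝ} (hpq : A ≤ d p q)
    (hxw : B ≤ d x w) (hwx : B ≤ d w x) (hpx : d p x ≤ S) (hxq : d x q ≤ S) (hpw : d p w ≤ S)
    (hwq : d w q ≤ S) : A + B - 2 * S ≤ gromovS d p q x w := by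
  unfold gromovS gromovProduct
  rcases min_cases (d p w + d w x - d p x) (d x w + d w q - d x q) with ⟨h, -⟩ | ⟨h, -⟩ <;>
    rw [h] <;> linarith

theorem exists_add_exp_neg_smul_sub_notMem (T : ℝ) {η : ℝ} (hη : c - η • e ∉ closure D) :
    ∃ a ≥ T, c + Real.exp (-a) • n - η • e ∉ D := by
  have htendsto : Tendsto (fun a : ℝ => c + Real.exp (-a) • n - η • e) atTop
      (𝓝 (c - η • e)) := by
    simpa using (((Real.tendsto_exp_neg_atTop_nhds_zero.smul_const n).const_add c).sub_const _)
  obtain ⟨a, ha, haT⟩ := ((htendsto.eventually (isClosed_closure.isOpen_compl.mem_nhds hη)).and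
    (eventually_ge_atTop T)).exists
  exact ⟨a, haT, fun h => ha (subset_closure h)⟩

-- In logarithmic coordinates `p q x w` is a square with vertical diagonal `p q` and horizontal
-- diagonal `x w`, of length `2 * T`, while its sides have length `T` in the maximum norm.
theorem exists_le_gromovS_of_bidisc_subset (hD : IsOpen D) (hc : Convex ℝ D)
    (hsub : bidisc c n e ⊆ D) (hface : ∀ t ∈ Ioc (0 : ℝ) 1, c + t • e ∉ D)
    (hcorner : ∀ η > (0 : ℝ), c - η • e ∉ closure D) {T : ℝ} (hT : 0 ≤ T) :
    ∃ p q x w : D, T - 3 / 2 * Real.log 2 ≤ gromovS (kobayashiDist D) p q x w := by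
  obtain ⟨a, haT, ha⟩ := exists_add_exp_neg_smul_sub_notMem (n := n) T
    (hcorner _ (Real.exp_pos (-(2 * T))))
  have hfaceT : c + Real.exp (-T) • e ∉ D :=
    hface _ ⟨Real.exp_pos _, Real.exp_le_one_iff.2 (neg_nonpos.2 hT)⟩
  have ha0 : 0 ≤ a := hT.trans haT
  have hleft : 0 ≤ a - T := sub_nonneg.2 haT
  have hright : 0 ≤ a + T := add_nonneg ha0 hT
  have htop : 0 ≤ 2 * T := mul_nonneg zero_le_two hT
  let point {s t : ℝ} (hs : 0 ≤ s) (ht : 0 ≤ t) : D :=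
    ⟨bidiscPoint c n e s t, hsub (bidiscPoint_mem_bidisc hs ht)⟩
  have side : ∀ {s t s' t' : ℝ} (hs : 0 ≤ s) (ht : 0 ≤ t) (hs' : 0 ≤ s') (ht' : 0 ≤ t'),
      |s - s'| ≤ T → |t - t'| ≤ T →
      kobayashiDist D (point hs ht) (point hs' ht') ≤ 1 / 2 * (T + Real.log 2) :=
    fun hs ht hs' ht' hsT htT =>
      kobayashiDist_le_of_bidisc_subset hsub hs ht hs' ht' hsT htT rfl rfl
  have vertical : 1 / 2 * (2 * T - Real.log 2) ≤
      kobayashiDist D (point ha0 le_rfl) (point ha0 htop) :=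
    half_sub_log_two_le_kobayashiDist_of_notMem hD hc ha rfl rfl
  have horizontal : ∀ {s s' : ℝ} (hs : 0 ≤ s) (hs' : 0 ≤ s'),
      1 / 2 * |s - s'| ≤ kobayashiDist D (point hs hT) (point hs' hT) := fun _ _ =>
    half_abs_sub_le_kobayashiDist_of_notMem hD hc hfaceT rfl rfl
  have hdefect := le_gromovS vertical (horizontal hright hleft)
    (abs_sub_comm (a + T) (a - T) ▸ horizontal hleft hright)
    (side ha0 le_rfl hright hT (abs_le.2 ⟨by linarith, by linarith⟩) (by simp [abs_of_nonneg hT]))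
    (side hright hT ha0 htop (abs_le.2 ⟨by linarith, by linarith⟩)
      (abs_le.2 ⟨by linarith, by linarith⟩))
    (side ha0 le_rfl hleft hT (abs_le.2 ⟨by linarith, by linarith⟩) (by simp [abs_of_nonneg hT]))
    (side hleft hT ha0 htop (abs_le.2 ⟨by linarith, by linarith⟩)
      (abs_le.2 ⟨by linarith, by linarith⟩))
  rw [add_sub_sub_cancel, abs_of_nonneg (add_nonneg hT hT)] at hdefect
  exact ⟨_, _, _, _, le_trans (by linarith) hdefect⟩

theorem not_isGromovHyperbolic_of_bidisc_subset (hD : IsOpen D) (hc : Convex ℝ D)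
    (hsub : bidisc c n e ⊆ D) (hface : ∀ t ∈ Ioc (0 : ℝ) 1, c + t • e ∉ D)
    (hcorner : ∀ η > (0 : ℝ), c - η • e ∉ closure D) :
    ¬ IsGromovHyperbolic (kobayashiDist D) := by
  rintro ⟨C, hC⟩
  obtain ⟨T, hT, hCT⟩ : ∃ T ≥ 0, C + 3 / 2 * Real.log 2 < T :=
    ⟨max 0 (C + 3 / 2 * Real.log 2 + 1), le_max_left _ _,
      (lt_add_one _).trans_le (le_max_right _ _)⟩
  obtain ⟨p, q, x, w, hle⟩ := exists_le_gromovS_of_bidisc_subset hD hc hsub hface hcorner hT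
  linarith [hC p q x w]

end Bidisc

section DefiningFunction

variable {E : Type*} [NormedAddCommGroup E] [NormedSpace ℝ E] {D U : Set E} {K : NNReal}
  {ρ : E → ℝ} {p q n : E} {g : E →L[ℝ] ℝ}

/-- `ρ` is a defining function of `D` of class `C^{1,1}` on the open set `U`, where `K` is a
Lipschitz constant of its derivative: the local data in `HasC11Boundary`. -/
structure IsC11DefiningFunction (D U : Set E) (K : NNReal) (ρ : E → ℝ) : Prop where
  isOpen : IsOpen U
  differentiableOn : DifferentiableOn ℝ ρ U
  lipschitzOnWith : LipschitzOnWith K (fderiv ℝ ρ) U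
  fderiv_ne_zero : ∀ x ∈ U, fderiv ℝ ρ x ≠ 0
  mem_iff_neg : ∀ x ∈ U, x ∈ D ↔ ρ x < 0

theorem IsC11DefiningFunction.differentiableAt (hρ : IsC11DefiningFunction D U K ρ) (hq : q ∈ U) :
    DifferentiableAt ℝ ρ q :=
  hρ.differentiableOn.differentiableAt (hρ.isOpen.mem_nhds hq)

theorem IsC11DefiningFunction.eq_zero_of_mem_frontier (hρ : IsC11DefiningFunction D U K ρ)
    (hD : IsOpen D) (hqU : q ∈ U) (hq : q ∈ frontier D) : ρ q = 0 := by
  rw [hD.frontier_eq] at hq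
  refine le_antisymm ?_ (not_lt.1 fun h => hq.2 ((hρ.mem_iff_neg q hqU).2 h))
  by_contra! hlt
  have hev : ∀ᶠ x in 𝓝 q, 0 < ρ x ∧ x ∈ U :=
    ((hρ.differentiableAt hqU).continuousAt.eventually (lt_mem_nhds hlt)).and
      (hρ.isOpen.mem_nhds hqU)
  obtain ⟨x, hxD, hx0, hxU⟩ := ((mem_closure_iff_frequently.1 hq.1).and_eventually hev).exists
  exact hx0.not_gt ((hρ.mem_iff_neg x hxU).1 hxD)

theorem IsC11DefiningFunction.fderiv_nonneg (hρ : IsC11DefiningFunction D U K ρ) (hD : IsOpen D)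
    (hqU : q ∈ U) (hq : q ∈ frontier D) (hg : ∀ z ∈ D, g q < g z) {v : E} (hv : g v ≤ 0) :
    0 ≤ fderiv ℝ ρ q v := by
  have hcont : Continuous fun t : ℝ => q + t • v := by fun_prop
  have hev : ∀ᶠ t in 𝓝[>] (0 : ℝ), q + t • v ∈ U :=
    (hcont.continuousAt.eventually_mem (by simpa using hρ.isOpen.mem_nhds hqU)).filter_mono
      nhdsWithin_le_nhds
  refine ge_of_tendsto
    ((hρ.differentiableAt hqU).hasFDerivAt.hasLineDerivAt v).tendsto_slope_zero_right ?_
  filter_upwards [hev, self_mem_nhdsWithin] with t htU ht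
  have ht0 : 0 < t := ht
  rw [hρ.eq_zero_of_mem_frontier hD hqU hq, sub_zero]
  refine smul_nonneg (inv_nonneg.2 ht0.le) (not_lt.1 fun hlt => ?_)
  have := hg _ ((hρ.mem_iff_neg _ htU).2 hlt)
  rw [map_add, map_smul, smul_eq_mul] at this
  linarith [mul_nonpos_of_nonneg_of_nonpos ht0.le hv]

theorem IsC11DefiningFunction.fderiv_apply_eq_mul (hρ : IsC11DefiningFunction D U K ρ)
    (hD : IsOpen D) (hqU : q ∈ U) (hq : q ∈ frontier D) (hg : ∀ z ∈ D, g q < g z) (hn : g n = 1)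
    (v : E) : fderiv ℝ ρ q v = g v * fderiv ℝ ρ q n := by
  have hker : g (v - g v • n) = 0 := by rw [map_sub, map_smul, hn, smul_eq_mul, mul_one, sub_self]
  have h1 := hρ.fderiv_nonneg hD hqU hq hg hker.le
  have h2 := hρ.fderiv_nonneg hD hqU hq hg (v := -(v - g v • n)) (by rw [map_neg, hker, neg_zero])
  rw [map_neg, neg_nonneg] at h2
  rw [← sub_eq_zero, ← smul_eq_mul, ← map_smul, ← map_sub]
  exact le_antisymm h2 h1

theorem IsC11DefiningFunction.fderiv_apply_neg (hρ : IsC11DefiningFunction D U K ρ)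
    (hD : IsOpen D) (hqU : q ∈ U) (hq : q ∈ frontier D) (hg : ∀ z ∈ D, g q < g z) (hn : g n = 1) :
    fderiv ℝ ρ q n < 0 := by
  have hle := hρ.fderiv_nonneg hD hqU hq hg (v := -n) (by rw [map_neg, hn]; norm_num)
  rw [map_neg, neg_nonneg] at hle
  refine hle.lt_of_ne fun h => hρ.fderiv_ne_zero q hqU ?_
  ext v
  rw [hρ.fderiv_apply_eq_mul hD hqU hq hg hn, h, mul_zero, zero_apply]

theorem apply_le_of_lipschitzOnWith_fderiv {s : Set E} (hs : Convex ℝ s)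
    (hρ : ∀ x ∈ s, DifferentiableAt ℝ ρ x) (hK : LipschitzOnWith K (fderiv ℝ ρ) s) {x y : E}
    (hx : x ∈ s) (hy : y ∈ s) : ρ y ≤ ρ x + fderiv ℝ ρ x (y - x) + K * ‖y - x‖ ^ 2 := by
  have hbound : ∀ z ∈ s ∩ closedBall x ‖y - x‖, ‖fderiv ℝ ρ z - fderiv ℝ ρ x‖ ≤ K * ‖y - x‖ :=
    fun z hz => (hK.norm_sub_le hz.1 hx).trans
      (mul_le_mul_of_nonneg_left (mem_closedBall_iff_norm.1 hz.2) K.2)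
  have hmean := (hs.inter (convex_closedBall x ‖y - x‖)).norm_image_sub_le_of_norm_fderiv_le'
    (fun z hz => hρ z hz.1) hbound ⟨hx, mem_closedBall_self (norm_nonneg _)⟩
    ⟨hy, mem_closedBall_iff_norm.2 le_rfl⟩
  linarith [(le_abs_self _).trans hmean]

-- The tangent hyperplanes at `p` and `q` are parallel to the kernel of `g`, so the Lipschitz
-- bound on the derivative gives paraboloids with the same axis and a common aperture.
theorem HasC11Boundary.exists_forall_add_mem (hs : HasC11Boundary D) (hD : IsOpen D)
    (hp : p ∈ frontier D) (hg : ∀ z ∈ D, g p < g z) :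
    ∃ C > 0, ∃ δ > 0, ∀ᶠ q in 𝓝 p, q ∈ frontier D → g q = g p →
      ∀ v ∈ ball (0 : E) δ, C * ‖v‖ ^ 2 < g v → q + v ∈ D := by
  obtain ⟨U, hU, hpU, ρ, K, hdiff, hK, hne, hmem⟩ := hs p hp
  have hρ : IsC11DefiningFunction D U K ρ := ⟨hU, hdiff, hK, hne, hmem⟩
  obtain ⟨n, hn⟩ : ∃ n, g n = 1 := by
    obtain ⟨z, hz⟩ := closure_nonempty_iff.1 ⟨p, frontier_subset_closure hp⟩
    have hpos : g (z - p) ≠ 0 := by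
      rw [map_sub]
      exact (sub_pos.2 (hg z hz)).ne'
    exact ⟨(g (z - p))⁻¹ • (z - p), by rw [map_smul, smul_eq_mul, inv_mul_cancel₀ hpos]⟩
  obtain ⟨m, hm, hm0⟩ := exists_between (hρ.fderiv_apply_neg hD hpU hp hg hn)
  obtain ⟨δ, hδ, hδU⟩ := Metric.isOpen_iff.1 hU p hpU
  have hcont : ContinuousAt (fun q => fderiv ℝ ρ q n) p :=
    (hK.continuousOn.continuousAt (hU.mem_nhds hpU)).clm_apply continuousAt_const
  refine ⟨(K + 1) / -m, div_pos (by positivity) (neg_pos.2 hm0), δ / 2, half_pos hδ, ?_⟩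
  filter_upwards [ball_mem_nhds p (half_pos hδ), hcont.eventually_lt_const hm]
    with q hqp hqm hq hqg v hv hCv
  have hqδ : q ∈ ball p δ := ball_subset_ball (half_le_self hδ.le) hqp
  have hqvδ : q + v ∈ ball p δ := by
    rw [mem_ball_iff_norm, add_sub_right_comm]
    linarith [norm_add_le (q - p) v, mem_ball_iff_norm.1 hqp, mem_ball_zero_iff.1 hv]
  have htaylor := apply_le_of_lipschitzOnWith_fderiv (convex_ball p δ)
    (fun x hx => hρ.differentiableAt (hδU hx)) (hK.mono hδU) hqδ hqvδ
  rw [add_sub_cancel_left, hρ.eq_zero_of_mem_frontier hD (hδU hqδ) hq, zero_add,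
    hρ.fderiv_apply_eq_mul hD (hδU hqδ) hq (hqg ▸ hg) hn] at htaylor
  rw [div_mul_eq_mul_div, div_lt_iff₀ (neg_pos.2 hm0)] at hCv
  have hgv : 0 < g v := by
    by_contra! h
    nlinarith [mul_nonneg (add_nonneg K.2 zero_le_one) (sq_nonneg ‖v‖)]
  refine (hmem _ (hδU hqvδ)).2 (htaylor.trans_lt ?_)
  linarith [mul_lt_mul_of_pos_left hqm hgv, sq_nonneg ‖v‖]

end DefiningFunction

section Face

variable {E : Type*} [NormedAddCommGroup E] [NormedSpace ℂ E] {D S : Set E}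

-- The Borel–Carathéodory inequality for every closed half-space containing `S`.
theorem IsHolomorphicDisc.add_smul_sub_mem {φ : ℂ → E} (hφ : IsHolomorphicDisc S φ)
    (hS : IsClosed S) (hc : Convex ℝ S) {α : ℂ} (hα : α ∈ ball (0 : ℂ) 1) {ξ : ℂ}
    (hξ : 2 * ‖α‖ * ‖ξ‖ ≤ 1 - ‖α‖) : φ 0 + ξ • (φ α - φ 0) ∈ S := by
  by_contra hmem
  obtain ⟨f, u, hu, hf⟩ := RCLike.geometric_hahn_banach_point_closed (𝕜 := ℂ) hc hS hmem
  have hu0 : u < (f (φ 0)).re := hf _ (hφ.2 (mem_ball_self one_pos))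
  have hα1 : 0 < 1 - ‖α‖ := sub_pos.2 (mem_ball_zero_iff.1 hα)
  have hmaps : MapsTo (fun ζ => f (φ 0) - f (φ ζ)) (ball 0 1)
      {z | z.re ≤ (f (φ 0)).re - u} := fun ζ hζ => by
    rw [mem_ofPred_eq, Complex.sub_re]
    exact sub_le_sub_left (hf _ (hφ.2 hζ)).le _
  have hbound := Complex.borelCaratheodory_zero (sub_pos.2 hu0)
    ((f.differentiable.comp_differentiableOn hφ.1).const_sub _) hmaps one_pos hα (sub_self _)
  have hle : ‖ξ‖ * ‖f (φ 0) - f (φ α)‖ ≤ (f (φ 0)).re - u := by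
    rw [le_div_iff₀ hα1] at hbound
    refine le_of_mul_le_mul_right ?_ hα1
    calc ‖ξ‖ * ‖f (φ 0) - f (φ α)‖ * (1 - ‖α‖)
        ≤ ‖ξ‖ * (2 * ((f (φ 0)).re - u) * ‖α‖) :=
          (mul_assoc _ _ _).trans_le (mul_le_mul_of_nonneg_left hbound (norm_nonneg ξ))
      _ = ((f (φ 0)).re - u) * (2 * ‖α‖ * ‖ξ‖) := by ring
      _ ≤ ((f (φ 0)).re - u) * (1 - ‖α‖) := mul_le_mul_of_nonneg_left hξ (sub_pos.2 hu0).le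
  have hre := (Complex.re_le_norm (ξ * (f (φ 0) - f (φ α)))).trans_eq (norm_mul _ _)
  replace hu : (f (φ 0 + ξ • (φ α - φ 0))).re < u := hu
  rw [map_add, map_smul, map_sub, smul_eq_mul, ← neg_sub (f (φ 0)), mul_neg, Complex.add_re,
    Complex.neg_re] at hu
  linarith

theorem ContainsComplexLine.of_closure (h : ContainsComplexLine (closure D)) (hD : IsOpen D)
    (hc : Convex ℝ D) : ContainsComplexLine D := by
  obtain ⟨a, v, hv, hline⟩ := h
  obtain ⟨b, hb⟩ : D.Nonempty := closure_nonempty_iff.1 ⟨_, hline 0⟩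
  refine ⟨midpoint ℝ b a, v, hv, fun ζ => ?_⟩
  have hmem := hc.openSegment_interior_closure_subset_interior (by rwa [hD.interior_eq])
    (hline (2 * ζ)) (midpoint_mem_openSegment b _)
  rw [hD.interior_eq] at hmem
  convert hmem using 1
  rw [midpoint_eq_smul_add, midpoint_eq_smul_add, ← add_assoc, smul_add (_ : ℝ) (b + a),
    ← smul_assoc]
  congr 2
  simp

theorem exists_closedBall_subset_forall_smul_notMem {F : Type*} [NormedAddCommGroup F]
    [NormedSpace ℝ F] [ProperSpace F] {A : Set F} (hA : IsClosed A) (hc : Convex ℝ A)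
    (h0 : A ∈ 𝓝 0) (hne : A ≠ univ) :
    ∃ b : F, closedBall 0 ‖b‖ ⊆ A ∧ ∀ t > (1 : ℝ), t • b ∉ A := by
  have hcompl : (closure Aᶜ).Nonempty :=
    closure_nonempty_iff.2 (nonempty_compl.2 hne)
  obtain ⟨b, hb, hbdist⟩ := isClosed_closure.exists_infDist_eq_dist hcompl 0
  rw [closure_compl] at hb hbdist
  rw [dist_zero_left] at hbdist
  have h0' : (0 : F) ∈ interior A := mem_interior_iff_mem_nhds.2 h0
  have hb0 : b ≠ 0 := fun h => hb (h ▸ h0')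
  refine ⟨b, ?_, fun t ht hmem => hb ?_⟩
  · rw [← closure_ball (0 : F) (norm_ne_zero_iff.2 hb0), ← hbdist]
    exact closure_minimal (ball_infDist_compl_subset.trans interior_subset) hA
  · have ht0 : 0 < t := one_pos.trans ht
    refine hc.openSegment_interior_self_subset_interior h0' hmem
      ⟨1 - t⁻¹, t⁻¹, sub_pos.2 (inv_lt_one_of_one_lt₀ ht), inv_pos.2 ht0, sub_add_cancel _ _, ?_⟩
    rw [smul_zero, zero_add, inv_smul_smul₀ ht0.ne']

-- Among the affine discs in `S` centred at `φ 0`, the largest one has a boundary point `c` where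
-- `S` ends in the radial direction.
theorem exists_affine_disc_of_holomorphicDisc (hS : IsClosed S) (hc : Convex ℝ S)
    (hlines : ¬ ContainsComplexLine S) {φ : ℂ → E} (hφ : IsHolomorphicDisc S φ) {α : ℂ}
    (hα : α ∈ ball (0 : ℂ) 1) (hne : φ α ≠ φ 0) :
    ∃ c e : E, c + e = φ 0 ∧ (∀ z ∈ closedBall (1 : ℂ) 1, c + z • e ∈ S) ∧
      ∀ η > (0 : ℝ), c - η • e ∉ S := by
  set v := φ α - φ 0
  have hcont : Continuous fun ξ : ℂ => φ 0 + ξ • v := by fun_prop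
  have hconv : Convex ℝ ((fun ξ : ℂ => φ 0 + ξ • v) ⁻¹' S) :=
    (hc.translate_preimage_right (φ 0)).linear_preimage
      ((LinearMap.toSpanSingleton ℂ E v).restrictScalars ℝ)
  have hnhds : (fun ξ : ℂ => φ 0 + ξ • v) ⁻¹' S ∈ 𝓝 0 := by
    have hlt : 2 * ‖α‖ * ‖(0 : ℂ)‖ < 1 - ‖α‖ := by
      simpa using mem_ball_zero_iff.1 hα
    have hcont' : Continuous fun ξ : ℂ => 2 * ‖α‖ * ‖ξ‖ := by fun_prop
    filter_upwards [hcont'.continuousAt.eventually_lt_const hlt] with ξ hξ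
    exact hφ.add_smul_sub_mem hS hc hα hξ.le
  obtain ⟨b, hball, hout⟩ := exists_closedBall_subset_forall_smul_notMem (hS.preimage hcont)
    hconv hnhds fun huniv => hlines ⟨φ 0, v, sub_ne_zero.2 hne, eq_univ_iff_forall.1 huniv⟩
  refine ⟨φ 0 + b • v, -(b • v), by abel, fun z hz => ?_, fun η hη hmem => ?_⟩
  · have : (1 - z) * b ∈ closedBall (0 : ℂ) ‖b‖ := by
      rw [mem_closedBall_zero_iff, norm_mul]
      exact mul_le_of_le_one_left (norm_nonneg b) (mem_closedBall_iff_norm'.1 hz)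
    have hmem : φ 0 + ((1 - z) * b) • v ∈ S := hball this
    rwa [sub_mul, one_mul, sub_smul, mul_smul, add_sub_assoc', sub_eq_add_neg, ← smul_neg] at hmem
  · refine hout (1 + η) (lt_add_of_pos_right 1 hη) ?_
    have hmem' : φ 0 + b • v + η • b • v ∈ S := by rwa [smul_neg, sub_neg_eq_add] at hmem
    rwa [mem_preimage, add_smul, one_smul, add_smul, smul_assoc, ← add_assoc]

theorem re_le_re_of_mem_closure {f : E →L[ℂ] ℂ} {u : ℝ} (hf : ∀ z ∈ D, u < (f z).re) :
    ∀ z ∈ closure D, u ≤ (f z).re := fun _ hz =>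
  closure_minimal (fun x hx => (hf x hx).le)
    (isClosed_le continuous_const (Complex.continuous_re.comp f.continuous)) hz

theorem apply_eq_zero_of_forall_re_le {f : E →L[ℂ] ℂ} {c e : E}
    (h : ∀ z ∈ closedBall (1 : ℂ) 1, (f (c + e)).re ≤ (f (c + z • e)).re) : f e = 0 := by
  have hle : ∀ w : ℂ, ‖w‖ = 1 → 0 ≤ (w * f e).re := fun w hw => by
    have := h (1 + w) (by simp [hw])
    rw [map_add, map_add, map_smul, smul_eq_mul, add_mul, one_mul, ← add_assoc,
      Complex.add_re _ (w * f e)] at this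
    exact nonneg_of_le_add_right this
  have h1 := hle 1 (by simp)
  have h2 := hle (-1) (by simp)
  have h3 := hle Complex.I (by simp)
  have h4 := hle (-Complex.I) (by simp)
  simp only [neg_mul, one_mul, Complex.neg_re, Complex.I_mul_re, neg_neg, neg_nonneg] at h1 h2 h3 h4
  exact Complex.ext (le_antisymm h2 h1) (le_antisymm h3 h4)

end Face

section Corner

variable {E : Type*} [NormedAddCommGroup E] [NormedSpace ℂ E] {D : Set E}

theorem sq_norm_lt_two_mul_re {z : ℂ} (hz : z ∈ ball (1 : ℂ) 1) : ‖z‖ ^ 2 < 2 * z.re := by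
  have hsq : ‖z - 1‖ ^ 2 < 1 :=
    pow_lt_one₀ (norm_nonneg _) (mem_ball_iff_norm.1 hz) two_ne_zero
  rw [Complex.sq_norm, Complex.normSq_apply] at hsq ⊢
  simp only [Complex.sub_re, Complex.sub_im, Complex.one_re, Complex.one_im] at hsq
  linarith

theorem exists_forall_smul_mem_paraboloid {f : E →L[ℂ] ℂ} (hf : f ≠ 0) {C δ : ℝ} (hC : 0 ≤ C)
    (hδ : 0 < δ) : ∃ n : E, ∀ z ∈ ball (1 : ℂ) 1,
      z • n ∈ ball (0 : E) δ ∧ C * ‖z • n‖ ^ 2 < (f (z • n)).re := by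
  obtain ⟨m, hm⟩ : ∃ m, f m = 1 := by
    obtain ⟨v, hv⟩ := DFunLike.ne_iff.1 hf
    exact ⟨(f v)⁻¹ • v, by rw [map_smul, smul_eq_mul, inv_mul_cancel₀ hv]⟩
  have hsmall : ∀ᶠ r in 𝓝[>] (0 : ℝ), 2 * (r * ‖m‖) < δ ∧ C * (2 * (r * ‖m‖ ^ 2)) < 1 := by
    refine (Eventually.and ?_ ?_).filter_mono nhdsWithin_le_nhds
    · exact (by fun_prop : Continuous fun r : ℝ => 2 * (r * ‖m‖)).continuousAt.eventually_lt_const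
        (by simpa using hδ)
    · exact (by fun_prop : Continuous fun r : ℝ => C * (2 * (r * ‖m‖ ^ 2))).continuousAt
        |>.eventually_lt_const (by simp)
  obtain ⟨r, ⟨hrδ, hrC⟩, hr⟩ := (hsmall.and self_mem_nhdsWithin).exists
  replace hr : 0 < r := hr
  refine ⟨r • m, fun z hz => ?_⟩
  have hz2 := sq_norm_lt_two_mul_re hz
  have hzre : 0 < z.re := by linarith [sq_nonneg ‖z‖]
  have hznorm : ‖z‖ ≤ 2 := by nlinarith [Complex.re_le_norm z]
  have hnorm : ‖z • r • m‖ = ‖z‖ * (r * ‖m‖) := by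
    rw [norm_smul, norm_smul, Real.norm_of_nonneg hr.le]
  have hre : (f (z • r • m)).re = z.re * r := by
    rw [map_smul, ← Complex.coe_smul, map_smul, hm]
    simp
  refine ⟨?_, ?_⟩
  · rw [mem_ball_zero_iff, hnorm]
    exact (mul_le_mul_of_nonneg_right hznorm (by positivity)).trans_lt hrδ
  · calc C * ‖z • r • m‖ ^ 2 = C * (r ^ 2 * ‖m‖ ^ 2) * ‖z‖ ^ 2 := by rw [hnorm]; ring
      _ ≤ C * (r ^ 2 * ‖m‖ ^ 2) * (2 * z.re) := mul_le_mul_of_nonneg_left hz2.le (by positivity)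
      _ = C * (2 * (r * ‖m‖ ^ 2)) * (z.re * r) := by ring
      _ < (f (z • r • m)).re := by
        rw [hre]
        exact mul_lt_of_lt_one_left (mul_pos hzre hr) hrC

theorem HasC11Boundary.exists_bidisc_subset (hs : HasC11Boundary D) (hD : IsOpen D)
    {f : E →L[ℂ] ℂ} {c e : E} (hf : ∀ z ∈ D, (f c).re < (f z).re) (hfe : f e = 0)
    (hface : ∀ z ∈ closedBall (1 : ℂ) 1, c + z • e ∈ closure D) :
    ∃ n : E, ∃ σ > (0 : ℝ), bidisc c n (σ • e) ⊆ D := by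
  have hfz : ∀ z : ℂ, f (c + z • e) = f c := fun z => by
    rw [map_add, map_smul, hfe, smul_zero, add_zero]
  have hfrontier : ∀ z ∈ closedBall (1 : ℂ) 1, c + z • e ∈ frontier D := fun z hz => by
    rw [hD.frontier_eq]
    exact ⟨hface z hz, fun hmem => (hf _ hmem).ne (congrArg Complex.re (hfz z)).symm⟩
  have hc : c ∈ frontier D := by simpa using hfrontier 0 (by simp)
  have hf0 : f ≠ 0 := by
    obtain ⟨z, hz⟩ := closure_nonempty_iff.1 ⟨c, frontier_subset_closure hc⟩
    rintro rfl
    simpa using hf z hz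
  obtain ⟨C, hC, δ, hδ, hparaboloid⟩ := hs.exists_forall_add_mem hD hc
    (g := Complex.reCLM.comp (f.restrictScalars ℝ)) hf
  have hcont : Continuous fun z : ℂ => c + z • e := by fun_prop
  obtain ⟨ε, hε, hnear⟩ := Metric.eventually_nhds_iff_ball.1
    ((hcont.tendsto' 0 c (by simp)).eventually hparaboloid)
  obtain ⟨n, hn⟩ := exists_forall_smul_mem_paraboloid hf0 hC.le hδ
  obtain ⟨σ, hσ0, hσ⟩ := exists_between (lt_min one_pos (half_pos hε))
  obtain ⟨hσ1, hσε⟩ := lt_min_iff.1 hσ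
  refine ⟨n, σ, hσ0, ?_⟩
  rintro _ ⟨z₁, hz₁, z₂, hz₂, rfl⟩
  have hz₂2 : ‖z₂‖ < 2 := by
    linarith [norm_le_norm_add_norm_sub' z₂ 1, mem_ball_iff_norm.1 hz₂, norm_one (α := ℂ)]
  have hσz : z₂ * σ ∈ ball (0 : ℂ) ε := by
    rw [mem_ball_zero_iff, norm_mul, Complex.norm_of_nonneg hσ0.le]
    nlinarith
  have hσz' : z₂ * σ ∈ closedBall (1 : ℂ) 1 := by
    have := (convex_closedBall (1 : ℂ) 1).smul_mem_of_zero_mem (by simp)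
      (ball_subset_closedBall hz₂) ⟨hσ0.le, hσ1.le⟩
    rwa [← Complex.coe_smul, smul_eq_mul, mul_comm] at this
  have hmem := hnear _ hσz (hfrontier _ hσz') (congrArg Complex.re (hfz _)) (z₁ • n) (hn z₁ hz₁).1
    (hn z₁ hz₁).2
  rwa [mul_smul, Complex.coe_smul, add_right_comm] at hmem

theorem ContainsAnalyticDisc.exists_corner (hdisc : ContainsAnalyticDisc (frontier D))
    (hD : IsOpen D) (hc : Convex ℝ D) (hlines : ¬ ContainsComplexLine D) :
    ∃ (f : E →L[ℂ] ℂ) (c e : E), (∀ z ∈ D, (f c).re < (f z).re) ∧ f e = 0 ∧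
      (∀ z ∈ closedBall (1 : ℂ) 1, c + z • e ∈ closure D) ∧
      ∀ η > (0 : ℝ), c - η • e ∉ closure D := by
  obtain ⟨φ, hφ, α, hα, hne⟩ := hdisc
  have hφ0 := hφ.2 (mem_ball_self one_pos)
  rw [hD.frontier_eq] at hφ0
  obtain ⟨f, hf⟩ := RCLike.geometric_hahn_banach_point_open (𝕜 := ℂ) hc hD hφ0.2
  obtain ⟨c, e, hce, hface, hcorner⟩ := exists_affine_disc_of_holomorphicDisc isClosed_closure
    hc.closure (fun h => hlines (h.of_closure hD hc))
    ⟨hφ.1, hφ.2.mono_right frontier_subset_closure⟩ hα hne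
  have hfe : f e = 0 := apply_eq_zero_of_forall_re_le fun z hz =>
    re_le_re_of_mem_closure (hce ▸ hf) _ (hface z hz)
  have hfc : f (φ 0) = f c := by rw [← hce, map_add, hfe, add_zero]
  exact ⟨f, c, e, fun z hz => hfc ▸ hf z hz, hfe, hface, hcorner⟩

end Corner

end KobGromov

theorem theorem1_general {E : Type*} [NormedAddCommGroup E] [NormedSpace ℂ E] (D : Set E)
    (hD_open : IsOpen D) (hD_convex : Convex ℝ D)
    (hD_lines : ¬ KobGromov.ContainsComplexLine D)
    (hD_smooth : KobGromov.HasC11Boundary D)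
    (hD_disc : KobGromov.ContainsAnalyticDisc (frontier D)) :
    ¬ KobGromov.IsGromovHyperbolic (KobGromov.kobayashiDist D) := by
  obtain ⟨f, c, e, hf, hfe, hface, hcorner⟩ := hD_disc.exists_corner hD_open hD_convex hD_lines
  obtain ⟨n, σ, hσ, hbidisc⟩ := hD_smooth.exists_bidisc_subset hD_open hf hfe hface
  refine KobGromov.not_isGromovHyperbolic_of_bidisc_subset hD_open hD_convex hbidisc
    (fun t _ hmem => ?_) (fun η hη => ?_)
  · have := hf _ hmem
    simp [← Complex.coe_smul, hfe] at this
  · rw [smul_smul]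
    exact hcorner _ (mul_pos hη hσ)

theorem theorem1 (D : Set (EuclideanSpace ℂ (Fin 2)))
    (hD_open : IsOpen D) (hD_convex : Convex ℝ D)
    (hD_lines : ¬ KobGromov.ContainsComplexLine D)
    (hD_smooth : KobGromov.HasC11Boundary D)
    (hD_disc : KobGromov.ContainsAnalyticDisc (frontier D)) :
    ¬ KobGromov.IsGromovHyperbolic (KobGromov.kobayashiDist D) :=
  theorem1_general D hD_open hD_convex hD_lines hD_smooth hD_disc
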